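/- Let $E$ be a finite set, let $\mathcal X$ be a Polish space with its Borel $\sigma$-algebra, write $\mathbb N=\{0,1,2,\dots\}$, $\mathbb N^*=\{1,2,\dots\}$, and equip $E^{\mathbb N}$, $E^{\mathbb N^*}$ with their product $\sigma$-algebras. For probability measures $\nu_1,\nu_2$ on $E$ let $d_{TV}(\nu_1,\nu_2)=\frac12\sum_{e\in E}|\nu_1(e)-\nu_2(e)|$. For every $x\in\mathcal X$ let $(q_t^x)_{t\in\mathbb Z}$ and $(\bar q_t^x)_{t\in\mathbb Z}$ be two sequences of probability kernels from $E^{\mathbb N}$ to $E$. Assume: (A1) for every $t\in\mathbb Z$ the maps $(y,z,x)\mapsto q_t^x(y\mid z)$ and $(y,z,x)\mapsto\bar q_t^x(y\mid z)$ on $E\times E^{\mathbb N}\times\mathcal X$ are measurable and take positive values; (A2) the numbers $$b_m=\sup\bigl\{d_{TV}\bigl(q_t^x(\cdot\mid y),q_t^x(\cdot\mid y')\bigr):\ t\in\mathbb Z,\ x\in\mathcal X,\ y,y'\in E^{\mathbb N},\ y_i=y'_i\text{ for }0\le i\le m-1\bigr\},\qquad m\in\mathbb N,$$ satisfy $b_0<1$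 and $\lim_{m\to\infty}b_m=0$. Fix $t_0\in\mathbb Z$. For $x\in\mathcal X$ and $z\in E^{\mathbb N}$ let $Q_{t_0,x,z}$ be the probability measure on $E^{\mathbb N^*}$ determined by $$Q_{t_0,x,z}\bigl(\{w: w_1=y_1,\dots,w_n=y_n\}\bigr)=\prod_{i=1}^n q_{t_0+i}^x\bigl(y_i\mid (y_{i-1},y_{i-2},\dots)\bigr),\qquad n\ge1,\ y_1,\dots,y_n\in E,$$ with the convention $y_{-j}=z_j$ for $j\ge0$; let $\overline Q_{t_0,x,z}$ be defined in the same way from $(\bar q_t^x)_t$. Let $(S_n)_{n\ge0}$ be the time-homogeneous Markov chain on $\mathbb N$ with $S_0=0$ and transition probabilities $P(i,i+1)=1-b_i$, $P(i,0)=b_i$ for $i\in\mathbb N$, and put $b_0^*=b_0$ and $b_n^*=\mathbb P(S_n=0)$ for $n\ge1$. Then there is a family $\widetilde Q_{t_0,x,z,\bar z}$, $(x,z,\bar z)\in\mathcal X\times E^{\mathbb N}\times E^{\mathbb N}$, of probability measures on $E^{\mathbb N^*}\times E^{\mathbb N^*}$ such that: 1. for all $x,z,\bar z$ and all measurable $A,B\subseteq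 E^{\mathbb N^*}$, $$\widetilde Q_{t_0,x,z,\bar z}(A\times E^{\mathbb N^*})=Q_{t_0,x,z}(A),\qquad \widetilde Q_{t_0,x,z,\bar z}(E^{\mathbb N^*}\times B)=\overline Q_{t_0,x,\bar z}(B);$$ 2. for all $x,z,\bar z$ and all integers $t\ge1$, $$\widetilde Q_{t_0,x,z,\bar z}\bigl(\{(y,\bar y): y_t\ne\bar y_t\}\bigr)\le b^*_{t-1}+\sup_{s\in E^{\mathbb N}}d_{TV}\bigl(q^x_{t+t_0}(\cdot\mid s),\bar q^x_{t+t_0}(\cdot\mid s)\bigr)+\sum_{\ell=0}^{t-2}b^*_\ell\,\sup_{s\in E^{\mathbb N}}d_{TV}\bigl(q^x_{t+t_0-\ell-1}(\cdot\mid s),\bar q^x_{t+t_0-\ell-1}(\cdot\mid s)\bigr);$$ 3. for every measurable $C\subseteq E^{\mathbb N^*}\times E^{\mathbb N^*}$, the map $(x,z,\bar z)\mapsto\widetilde Q_{t_0,x,z,\bar z}(C)$ is measurable on $\mathcal X\times E^{\mathbb N}\times E^{\mathbb N}$. -/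

import Mathlib

open MeasureTheory ProbabilityTheory Filter Topology

noncomputable section

namespace CompleteConnections

/-- The past `(y_n, y_{n-1}, …, y_1, z_0, z_1, …)` seen after time `n`, for a path with values
`y_1, …, y_n` at times `1, …, n` and `y_{-j} = z_j` for `j ≥ 0`. The history `h` is indexed by
`0, …, n`; its value at time `0` is not used. -/
def past {E : Type*} (z : ℕ → E) (n : ℕ) (h : Finset.Iic n → E) : ℕ → E :=
  fun j => if j < n then h ⟨n - j, Finset.mem_Iic.2 (Nat.sub_le n j)⟩ else z (j - n)

theorem measurable_past {E : Type*} [MeasurableSpace E] (z : ℕ → E) (n : ℕ) :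
    Measurable (past z n) := by
  refine measurable_pi_lambda _ fun j => ?_
  unfold past
  split_ifs
  · exact measurable_pi_apply _
  · exact measurable_const

/-- The conditional law of `y_{n+1}` given `y_1, …, y_n`: the kernel `q_{t₀+n+1}` at the past. -/
def stepKernel {E : Type*} [MeasurableSpace E] (q : ℤ → Kernel (ℕ → E) E) (t₀ : ℤ) (z : ℕ → E)
    (n : ℕ) : Kernel (Finset.Iic n → E) E :=
  (q (t₀ + n + 1)).comap (past z n) (measurable_past z n)

instance {E : Type*} [MeasurableSpace E] (q : ℤ → Kernel (ℕ → E) E) [∀ t, IsMarkovKernel (q t)]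
    (t₀ : ℤ) (z : ℕ → E) (n : ℕ) : IsMarkovKernel (stepKernel q t₀ z n) := by
  unfold stepKernel; infer_instance

/-- The law of `(y_i)_{i ≥ 1}` for the chain with complete connections that has the past `z` at
time `t₀` and the transition kernels `q_{t₀+1}, q_{t₀+2}, …`, obtained from the Ionescu-Tulcea
theorem; see `pathLaw_cylinder` for its values on cylinders. -/
def pathLaw {E : Type*} [MeasurableSpace E] (q : ℤ → Kernel (ℕ → E) E) [∀ t, IsMarkovKernel (q t)]
    (t₀ : ℤ) (z : ℕ → E) : Measure (ℕ+ → E) :=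
  (Kernel.traj (X := fun _ => E) (stepKernel q t₀ z) 0 (fun _ => z 0)).map
    (fun w (i : ℕ+) => w (i : ℕ))

/-- The values of `pathLaw` on cylinders: the probability of `y_1, …, y_n` is the product of the
transition probabilities `q_{t₀+i}(y_i | y_{i-1}, y_{i-2}, …)` for `1 ≤ i ≤ n`, where
`y_{-j} = z_j` for `j ≥ 0`. -/
theorem pathLaw_cylinder {E : Type*} [MeasurableSpace E] [MeasurableSingletonClass E]
    (q : ℤ → Kernel (ℕ → E) E) [∀ t, IsMarkovKernel (q t)] (t₀ : ℤ) (z : ℕ → E)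
    (y : ℕ → E) (n : ℕ) :
    pathLaw q t₀ z {w | ∀ i : ℕ+, (i : ℕ) ≤ n → w i = y i} =
      ∏ i ∈ Finset.range n, q (t₀ + i + 1) (past z i fun k => y k) {y (i + 1)} := by
  have hs : ∀ {ι : Type} (i : ι) (e : E),
      MeasurableSet {w : ι → E | w i = e} := fun i e =>
    (measurable_pi_apply i : Measurable fun w : _ → E => w i) (measurableSet_singleton e)
  have hm : ∀ n : ℕ, MeasurableSet {w : ℕ+ → E | ∀ i : ℕ+, (i : ℕ) ≤ n → w i = y i} := by
    intro n
    simp only [Set.ofPred_forall]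
    exact MeasurableSet.iInter fun i => MeasurableSet.iInter fun _ =>
      hs i (y i)
  have hA : ∀ n : ℕ, MeasurableSet {h : Finset.Iic n → E | ∀ i : Finset.Iic n, 1 ≤ (i : ℕ) → h i = y i} := by
    intro n
    simp only [Set.ofPred_forall]
    exact MeasurableSet.iInter fun i => MeasurableSet.iInter fun _ =>
      hs i (y i)
  have hf : Measurable fun (w : ℕ → E) (i : ℕ+) => w (i : ℕ) :=
    measurable_pi_lambda _ fun i => measurable_pi_apply _
  induction n with
  | zero =>
    have : {w : ℕ+ → E | ∀ i : ℕ+, (i : ℕ) ≤ 0 → w i = y i} = Set.univ := by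
      ext w
      simp
    rw [this, pathLaw, Measure.map_apply hf MeasurableSet.univ]
    simp
  | succ n ih =>
    rw [Finset.prod_range_succ, ← ih, pathLaw, Measure.map_apply hf (hm _),
      Measure.map_apply hf (hm _)]
    have h1 : (fun (w : ℕ → E) (i : ℕ+) => w (i : ℕ)) ⁻¹'
          {w : ℕ+ → E | ∀ i : ℕ+, (i : ℕ) ≤ n + 1 → w i = y i} =
        (fun w : ℕ → E => (Preorder.frestrictLe (π := fun _ => E) n w, w (n + 1))) ⁻¹'
          ({h : Finset.Iic n → E | ∀ i : Finset.Iic n, 1 ≤ (i : ℕ) → h i = y i} ×ˢ {y (n + 1)}) := by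
      ext w
      simp only [Set.mem_preimage, Set.mem_ofPred_eq, Set.mem_prod, Set.mem_singleton_iff]
      constructor
      · intro h
        exact ⟨fun i hi => h ⟨i, hi⟩ (by have := Finset.mem_Iic.1 i.2; simp; omega),
          h ⟨n + 1, by omega⟩ le_rfl⟩
      · rintro ⟨h, h'⟩ i hi
        rcases Nat.lt_or_ge n i with hlt | hle
        · have : (i : ℕ) = n + 1 := by omega
          rw [this, h']
        · exact h ⟨i, Finset.mem_Iic.2 hle⟩ i.pos
    have h2 : (fun (w : ℕ → E) (i : ℕ+) => w (i : ℕ)) ⁻¹'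
          {w : ℕ+ → E | ∀ i : ℕ+, (i : ℕ) ≤ n → w i = y i} =
        Preorder.frestrictLe (π := fun _ => E) n ⁻¹'
          {h : Finset.Iic n → E | ∀ i : Finset.Iic n, 1 ≤ (i : ℕ) → h i = y i} := by
      ext w
      simp only [Set.mem_preimage, Set.mem_ofPred_eq]
      constructor
      · intro h i hi
        exact h ⟨i, hi⟩ (Finset.mem_Iic.1 i.2)
      · intro h i hi
        exact h ⟨i, Finset.mem_Iic.2 hi⟩ i.pos
    rw [h1, h2, ← Measure.map_apply (by fun_prop) ((hA n).prod (measurableSet_singleton _)),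
      ← Kernel.partialTraj_compProd_eq_map_traj (Nat.zero_le n),
      ← Measure.map_apply (by fun_prop) (hA n), Kernel.traj_map_frestrictLe_apply,
      Measure.compProd_apply_prod (hA n) (measurableSet_singleton _),
      setLIntegral_congr_fun (g := fun _ =>
        q (t₀ + n + 1) (past z n fun k => y k) {y (n + 1)}) (hA n), setLIntegral_const, mul_comm]
    intro h hh
    have : past z n h = past z n fun k => y k := by
      funext j
      unfold past
      split_ifs with hj
      · exact hh _ (by simp; omega)
      · rfl
    simp only [stepKernel, Kernel.comap_apply, this]

/-- Total variation distance on a finite set. -/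
def dTV {E : Type*} [Fintype E] [MeasurableSpace E] (μ ν : Measure E) : ℝ :=
  (1 / 2) * ∑ e : E, |μ.real {e} - ν.real {e}|

/-- The continuity coefficient `b_m`: the supremum of the total variation distances between
`q_t^x(·|y)` and `q_t^x(·|y')`, over `t`, `x` and all `y, y'` with `y_i = y'_i` for `i < m`. -/
def contCoeff {E 𝒳 : Type*} [Fintype E] [MeasurableSpace E]
    (q : ℤ → 𝒳 → Kernel (ℕ → E) E) (m : ℕ) : ℝ :=
  sSup {r : ℝ | ∃ (t : ℤ) (x : 𝒳) (y y' : ℕ → E), (∀ i < m, y i = y' i) ∧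
    r = dTV (q t x y) (q t x y')}

/-- The transition kernel on `ℕ` with `P(i, i+1) = 1 - b_i` and `P(i, 0) = b_i`. -/
def renewalKernel (b : ℕ → ℝ) : Kernel ℕ ℕ where
  toFun i := ENNReal.ofReal (1 - b i) • Measure.dirac (i + 1) +
    ENNReal.ofReal (b i) • Measure.dirac 0
  measurable' := measurable_from_top

theorem isMarkovKernel_renewalKernel {b : ℕ → ℝ} (hb : ∀ i, b i ∈ Set.Icc (0 : ℝ) 1) :
    IsMarkovKernel (renewalKernel b) := by
  refine ⟨fun i => ⟨?_⟩⟩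
  have h := hb i
  simp only [renewalKernel, Kernel.coe_mk, Measure.add_apply, Measure.smul_apply, measure_univ,
    smul_eq_mul, mul_one]
  rw [← ENNReal.ofReal_add (by linarith [h.2]) h.1]
  simp

/-- The law of `(S_n)_{n ≥ 1}`, where `(S_n)_{n ≥ 0}` is the time-homogeneous Markov chain with
`S_0 = 0` and transition kernel `renewalKernel b`. A Markov chain is the chain with complete
connections whose kernel only reads the last value of the past. -/
def renewalLaw (b : ℕ → ℝ) (hb : ∀ i, b i ∈ Set.Icc (0 : ℝ) 1) : Measure (ℕ+ → ℕ) :=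
  haveI := isMarkovKernel_renewalKernel hb
  pathLaw (fun _ => (renewalKernel b).comap (fun y : ℕ → ℕ => y 0) (measurable_pi_apply 0)) 0
    (fun _ => 0)

/-- `b*_0 = b_0` and `b*_n = P(S_n = 0)` for `n ≥ 1`. -/
def starCoeff (b : ℕ → ℝ) (hb : ∀ i, b i ∈ Set.Icc (0 : ℝ) 1) : ℕ → ℝ
  | 0 => b 0
  | n + 1 => (renewalLaw b hb).real {S | S n.succPNat = 0}

theorem dTV_mem_Icc {E : Type*} [Fintype E] [MeasurableSpace E] [DiscreteMeasurableSpace E]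
    (μ ν : Measure E) [IsProbabilityMeasure μ] [IsProbabilityMeasure ν] :
    dTV μ ν ∈ Set.Icc (0 : ℝ) 1 := by
  have hs : ∀ ρ : Measure E, IsProbabilityMeasure ρ → ∑ e : E, ρ.real {e} = 1 := by
    intro ρ _
    rw [sum_measureReal_singleton]
    simp
  unfold dTV
  constructor
  · positivity
  · have h : ∑ e : E, |μ.real {e} - ν.real {e}| ≤ ∑ e : E, (μ.real {e} + ν.real {e}) := by
      refine Finset.sum_le_sum fun e _ => ?_
      rw [abs_le]
      constructor <;> linarith [measureReal_nonneg (μ := μ) (s := {e}),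
        measureReal_nonneg (μ := ν) (s := {e})]
    rw [Finset.sum_add_distrib, hs μ inferInstance, hs ν inferInstance] at h
    linarith

theorem contCoeff_mem_Icc {E 𝒳 : Type*} [Fintype E] [MeasurableSpace E]
    [DiscreteMeasurableSpace E] (q : ℤ → 𝒳 → Kernel (ℕ → E) E) [∀ t x, IsMarkovKernel (q t x)]
    (m : ℕ) : contCoeff q m ∈ Set.Icc (0 : ℝ) 1 := by
  constructor
  · refine Real.sSup_nonneg ?_
    rintro r ⟨t, x, y, y', -, rfl⟩
    exact (dTV_mem_Icc _ _).1
  · refine Real.sSup_le ?_ zero_le_one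
    rintro r ⟨t, x, y, y', -, rfl⟩
    exact (dTV_mem_Icc _ _).2

/-- The coefficients `b*_n` built from the continuity coefficients of `q`. -/
def bStar {E 𝒳 : Type*} [Fintype E] [MeasurableSpace E] [DiscreteMeasurableSpace E]
    (q : ℤ → 𝒳 → Kernel (ℕ → E) E) [∀ t x, IsMarkovKernel (q t x)] : ℕ → ℝ :=
  starCoeff (contCoeff q) (contCoeff_mem_Icc q)

end CompleteConnections

end

/-! The two chains are run together: given both pasts, the next pair is drawn from the maximal
coupling of $q(\cdot\mid y)$ and $\bar q(\cdot\mid\bar y)$. The marginals are then correct because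
each step has the correct marginals (`map_pathLaw`), and measurability in the parameters can be read
off the explicit cylinder probabilities.

For the estimate, let $L_k$ be the number of latest consecutive agreements at time $k$, with
$L_0=0$. By the triangle inequality, a step from $L_k=i$ fails with probability at most
$b_i+\delta_k$, where $\delta_k$ is the supremum over pasts of the distance between the kernels used
at that step (`coupledKernel_ne_le`). So $L$ behaves like the renewal chain $S$, up to the extra
failures $\delta_k$.

Let $R_m(i)$ be the probability that $S$ started at $i$ is at $0$ after $m$ steps. It is decreasing
in $i$ (`returnProb_antitone`), hence a higher failure probability only increases the average of
$R_m$, and $\mathbb E R_m(L_{k+1})\le\mathbb E R_{m+1}(L_k)+\delta_k R_m(0)$. Iterating down to time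
$0$ bounds the probability of disagreement at time $n+1$ by $R_{n+1}(0)+\sum_{j\le
n}\delta_jR_{n-j}(0)$ (`trajLaw_coupled_ne_le`). Finally $R_{n+1}(0)\le b^*_n$
(`returnProb_le_starCoeff`). -/

noncomputable section

namespace CompleteConnections

/-! ### Cylinders generate the product σ-algebra -/

section Cylinders

/-- The sets of paths on `ℕ+` with prescribed values at the times `1, …, n`. -/
def pathCylinders (E : Type*) : Set (Set (ℕ+ → E)) :=
  {s | ∃ (n : ℕ) (y : ℕ → E), s = {w | ∀ i : ℕ+, (i : ℕ) ≤ n → w i = y i}}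

/-- If two cylinders share a path `v`, their intersection is the cylinder of `v` up to the larger of
the two lengths. -/
theorem isPiSystem_pathCylinders (E : Type*) : IsPiSystem (pathCylinders E) := by
  rintro _ ⟨n, y, rfl⟩ _ ⟨m, y', rfl⟩ ⟨v, hv, hv'⟩
  refine ⟨max n m, fun k => if h : 0 < k then v ⟨k, h⟩ else y k, ?_⟩
  ext w
  simp only [Set.mem_inter_iff, Set.mem_ofPred_eq] at hv hv' ⊢
  constructor
  · rintro ⟨h, h'⟩ i hi
    have hv_eq : (if h : 0 < (i : ℕ) then v ⟨i, h⟩ else y i) = v i :=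
      dif_pos i.pos
    rw [hv_eq]
    rcases le_max_iff.1 hi with hi | hi
    · rw [h i hi, hv i hi]
    · rw [h' i hi, hv' i hi]
  · intro h
    have hw : ∀ i : ℕ+, (i : ℕ) ≤ max n m → w i = v i := fun i hi =>
      (h i hi).trans (dif_pos i.pos)
    exact ⟨fun i hi => (hw i (le_max_of_le_left hi)).trans (hv i hi),
      fun i hi => (hw i (le_max_of_le_right hi)).trans (hv' i hi)⟩

theorem measurableSet_pathCylinder {E : Type*} [MeasurableSpace E] [MeasurableSingletonClass E]
    (y : ℕ → E) (n : ℕ) : MeasurableSet {w : ℕ+ → E | ∀ i : ℕ+, (i : ℕ) ≤ n → w i = y i} := by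
  simp only [Set.ofPred_forall]
  exact MeasurableSet.iInter fun i => MeasurableSet.iInter fun _ =>
    (measurable_pi_apply i : Measurable fun w : ℕ+ → E => w i) (measurableSet_singleton _)

theorem generateFrom_pathCylinders (E : Type*) [Countable E] [MeasurableSpace E]
    [MeasurableSingletonClass E] :
    (MeasurableSpace.pi : MeasurableSpace (ℕ+ → E)) =
      MeasurableSpace.generateFrom (pathCylinders E) := by
  apply le_antisymm
  · refine iSup_le fun i => ?_
    rw [← measurable_iff_comap_le]
    refine @measurable_to_countable' E (ℕ+ → E) _ _ (MeasurableSpace.generateFrom _) _ fun e => ?_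
    -- A coordinate event is a countable union of cylinders, one for each history up to time `i`
    -- ending in `e`; the default `e` beyond time `i` plays no role.
    have h : (fun w : ℕ+ → E => w i) ⁻¹' {e} =
        ⋃ g : {g : Finset.Iic (i : ℕ) → E // g ⟨i, Finset.mem_Iic.2 le_rfl⟩ = e},
          {w | ∀ j : ℕ+, (j : ℕ) ≤ i →
            w j = if h : (j : ℕ) ≤ i then g.1 ⟨j, Finset.mem_Iic.2 h⟩ else e} := by
      ext w
      simp only [Set.mem_preimage, Set.mem_singleton_iff, Set.mem_iUnion, Set.mem_ofPred_eq]
      constructor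
      · intro hw
        refine ⟨⟨fun k => if h : 0 < (k : ℕ) then w ⟨k, h⟩ else e, ?_⟩, ?_⟩
        · exact (dif_pos i.pos).trans hw
        · intro j hj
          rw [dif_pos hj]
          simp only [j.pos, dif_pos]
          rfl
      · rintro ⟨g, hg⟩
        rw [hg i le_rfl]
        simpa using g.2
    rw [h]
    exact MeasurableSet.iUnion fun g => MeasurableSpace.measurableSet_generateFrom
      ⟨i, fun j => if h : j ≤ i then g.1 ⟨j, Finset.mem_Iic.2 h⟩ else e, rfl⟩
  · refine MeasurableSpace.generateFrom_le ?_
    rintro _ ⟨n, y, rfl⟩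
    exact measurableSet_pathCylinder y n

end Cylinders

/-! ### Pasts built from a path -/

section Past

variable {E : Type*}

/-- The history of a path up to time `n`. -/
abbrev history (n : ℕ) (w : ℕ → E) : Finset.Iic n → E :=
  Preorder.frestrictLe (π := fun _ => E) n w

theorem past_succ_zero (z : ℕ → E) (n : ℕ) (w : ℕ → E) :
    past z (n + 1) (history (n + 1) w) 0 = w (n + 1) := by
  simp [past]

theorem past_succ_succ (z : ℕ → E) (n : ℕ) (w : ℕ → E) (i : ℕ) :
    past z (n + 1) (history (n + 1) w) (i + 1) = past z n (history n w) i := by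
  simp [past]

theorem map_past {F : Type*} (f : E → F) (z : ℕ → E) (n : ℕ) (h : Finset.Iic n → E) (i : ℕ) :
    f (past z n h i) = past (fun j => f (z j)) n (fun k => f (h k)) i := by
  unfold past
  split_ifs <;> rfl

theorem past_congr (z : ℕ → E) (n : ℕ) {h h' : Finset.Iic n → E}
    (hh : ∀ k : Finset.Iic n, 1 ≤ (k : ℕ) → h k = h' k) : past z n h = past z n h' := by
  funext j
  unfold past
  split_ifs with hj
  · exact hh _ (by simp; omega)
  · rfl

end Past

/-! ### Path laws: disintegration and projection -/

section Trajectory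

variable {E : Type*} [MeasurableSpace E]

instance (q : ℤ → Kernel (ℕ → E) E) [∀ t, IsMarkovKernel (q t)] (t₀ : ℤ) (z : ℕ → E) :
    IsProbabilityMeasure (pathLaw q t₀ z) := by
  unfold pathLaw
  exact Measure.isProbabilityMeasure_map
    (measurable_pi_lambda _ fun i => measurable_pi_apply _).aemeasurable

/-- The law on `ℕ → E` whose image on `ℕ+ → E` is `pathLaw`. -/
abbrev trajLaw (q : ℤ → Kernel (ℕ → E) E) [∀ t, IsMarkovKernel (q t)] (t₀ : ℤ) (z : ℕ → E) :
    Measure (ℕ → E) :=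
  Kernel.traj (X := fun _ => E) (stepKernel q t₀ z) 0 (fun _ => z 0)

theorem pathLaw_apply (q : ℤ → Kernel (ℕ → E) E) [∀ t, IsMarkovKernel (q t)] (t₀ : ℤ)
    (z : ℕ → E) {A : Set (ℕ+ → E)} (hA : MeasurableSet A) :
    pathLaw q t₀ z A = trajLaw q t₀ z {w | (fun i : ℕ+ => w i) ∈ A} := by
  rw [pathLaw, Measure.map_apply (measurable_pi_lambda _ fun i => measurable_pi_apply _) hA]
  rfl

/-- One-step disintegration of the path law. -/
theorem lintegral_trajLaw_succ (q : ℤ → Kernel (ℕ → E) E) [∀ t, IsMarkovKernel (q t)] (t₀ : ℤ)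
    (z : ℕ → E) (n : ℕ) {F : (Finset.Iic n → E) × E → ENNReal} (hF : Measurable F) :
    ∫⁻ w, F (history n w, w (n + 1)) ∂trajLaw q t₀ z =
      ∫⁻ w, ∫⁻ e, F (history n w, e) ∂q (t₀ + n + 1) (past z n (history n w))
        ∂trajLaw q t₀ z := by
  have h := lintegral_map (μ := trajLaw q t₀ z) hF
    (g := fun w => (history n w, w (n + 1))) (by fun_prop)
  rw [← h, ← Kernel.partialTraj_compProd_eq_map_traj (Nat.zero_le n),
    Measure.lintegral_compProd hF, ← Kernel.traj_map_frestrictLe_apply,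
    lintegral_map hF.lintegral_kernel_prod_right' (by fun_prop)]
  rfl

theorem measurable_past_left (n : ℕ) (h : Finset.Iic n → E) :
    Measurable fun z : ℕ → E => past z n h := by
  refine measurable_pi_lambda _ fun j => ?_
  unfold past
  split_ifs
  · exact measurable_const
  · exact measurable_pi_apply _

/-- If the kernels of a chain on `E` project under `f` to kernels on `F`, then so do the path
laws. -/
theorem map_pathLaw {F : Type*} [MeasurableSpace F] [Countable F] [MeasurableSingletonClass F]
    {f : E → F} (hf : Measurable f)
    (q : ℤ → Kernel (ℕ → E) E) [∀ t, IsMarkovKernel (q t)]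
    (r : ℤ → Kernel (ℕ → F) F) [∀ t, IsMarkovKernel (r t)]
    (hqr : ∀ t v e, q t v (f ⁻¹' {e}) = r t (fun i => f (v i)) {e}) (t₀ : ℤ) (z : ℕ → E) :
    (pathLaw q t₀ z).map (fun w i => f (w i)) = pathLaw r t₀ (fun j => f (z j)) := by
  have hfm : Measurable fun (w : ℕ+ → E) (i : ℕ+) => f (w i) := by fun_prop
  have := Measure.isProbabilityMeasure_map (μ := pathLaw q t₀ z) hfm.aemeasurable
  refine ext_of_generate_finite _ (generateFrom_pathCylinders F) (isPiSystem_pathCylinders F) ?_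
    (by simp)
  rintro _ ⟨n, y, rfl⟩
  rw [pathLaw_cylinder, Measure.map_apply hfm (measurableSet_pathCylinder y n),
    pathLaw_apply _ _ _ (hfm (measurableSet_pathCylinder y n))]
  simp only [Set.mem_preimage, Set.mem_ofPred_eq]
  have hA : ∀ n : ℕ, MeasurableSet
      {h : Finset.Iic n → E | ∀ k : Finset.Iic n, 1 ≤ (k : ℕ) → f (h k) = y k} := by
    intro n
    simp only [Set.ofPred_forall]
    exact MeasurableSet.iInter fun i => MeasurableSet.iInter fun _ =>
      (hf.comp (measurable_pi_apply i)) (measurableSet_singleton _)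
  have hset : ∀ n : ℕ, {w : ℕ → E | ∀ i : ℕ+, (i : ℕ) ≤ n → f (w i) = y i} =
      history n ⁻¹' {h | ∀ k : Finset.Iic n, 1 ≤ (k : ℕ) → f (h k) = y k} := by
    intro n
    ext w
    constructor
    · intro h k hk
      exact h ⟨k, hk⟩ (Finset.mem_Iic.1 k.2)
    · intro h i hi
      exact h ⟨i, Finset.mem_Iic.2 hi⟩ i.pos
  induction n with
  | zero =>
    simp
  | succ n ih =>
    set A : Set (Finset.Iic n → E) := {h | ∀ k : Finset.Iic n, 1 ≤ (k : ℕ) → f (h k) = y k}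
    have hB : MeasurableSet (A ×ˢ (f ⁻¹' {y (n + 1)})) :=
      (hA n).prod (hf (measurableSet_singleton _))
    have hsucc : {w : ℕ → E | ∀ i : ℕ+, (i : ℕ) ≤ n + 1 → f (w i) = y i} =
        (fun w => (history n w, w (n + 1))) ⁻¹' (A ×ˢ (f ⁻¹' {y (n + 1)})) := by
      ext w
      constructor
      · intro h
        exact ⟨fun k hk => h ⟨k, hk⟩ (by have := Finset.mem_Iic.1 k.2; simp; omega),
          h ⟨n + 1, by omega⟩ le_rfl⟩
      · rintro ⟨h, h'⟩ i hi
        rcases Nat.lt_or_ge n i with hlt | hle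
        · have : (i : ℕ) = n + 1 := by omega
          rw [this]
          exact h'
        · exact h ⟨i, Finset.mem_Iic.2 hle⟩ i.pos
    have hm : Measurable fun w : ℕ → E => (history n w, w (n + 1)) := by fun_prop
    have hmA : MeasurableSet (history n ⁻¹' A) :=
      (Preorder.measurable_frestrictLe (X := fun _ => E) n) (hA n)
    rw [Finset.prod_range_succ, ← ih, hsucc, hset n, ← lintegral_indicator_one (hm hB)]
    have hstep := lintegral_trajLaw_succ q t₀ z n
      (F := (A ×ˢ (f ⁻¹' {y (n + 1)})).indicator 1) (measurable_one.indicator hB)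
    refine Eq.trans hstep ?_
    rw [mul_comm, ← lintegral_indicator_const hmA]
    refine lintegral_congr fun w => ?_
    -- On `A` the projected past depends only on `y` and the projection of `z`, so the conditional
    -- probability of the last value is the constant factor in the product.
    by_cases hw : history n w ∈ A
    · rw [Set.indicator_of_mem (show w ∈ history n ⁻¹' A from hw)]
      have h1 : ∀ e, (A ×ˢ (f ⁻¹' {y (n + 1)})).indicator (1 : (Finset.Iic n → E) × E → ENNReal) (history n w, e) =
          (f ⁻¹' {y (n + 1)}).indicator 1 e := by
        intro e
        by_cases he : f e = y (n + 1) <;> simp [Set.indicator, hw, he]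
      simp only [h1]
      rw [lintegral_indicator_one (hf (measurableSet_singleton _)), hqr]
      congr 2
      funext i
      rw [map_past f]
      exact congrFun (past_congr _ n hw) i
    · rw [Set.indicator_of_notMem (show w ∉ history n ⁻¹' A from hw)]
      simp [Set.indicator, Set.mem_prod, hw]

end Trajectory

/-! ### Maximal coupling on a finite set -/

section Coupling

/-- The common mass of two measures on a finite set at a point. -/
def commonMass {E : Type*} [MeasurableSpace E] (μ ν : Measure E) (e : E) : ℝ := min (μ.real {e}) (ν.real {e})

theorem commonMass_comm {E : Type*} [MeasurableSpace E] (μ ν : Measure E) : commonMass μ ν = commonMass ν μ := by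
  funext e
  exact min_comm _ _

variable {E : Type*} [Fintype E] [MeasurableSpace E]

theorem dTV_triangle (μ ν ρ : Measure E) : dTV μ ρ ≤ dTV μ ν + dTV ν ρ := by
  unfold dTV
  rw [← mul_add, ← Finset.sum_add_distrib]
  gcongr
  exact abs_sub_le _ _ _

open Classical in
/-- The weights of the maximal coupling of two probability measures on a finite set. -/
def couplingWeight (μ ν : Measure E) (p : E × E) : ℝ :=
  (if p.1 = p.2 then commonMass μ ν p.1 else 0) +
    (μ.real {p.1} - commonMass μ ν p.1) * (ν.real {p.2} - commonMass μ ν p.2) / dTV μ ν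

/-- The maximal coupling of two probability measures on a finite set. -/
def maxCoupling (μ ν : Measure E) : Measure (E × E) :=
  ∑ p : E × E, ENNReal.ofReal (couplingWeight μ ν p) • Measure.dirac p

theorem couplingWeight_nonneg (μ ν : Measure E) (p : E × E) : 0 ≤ couplingWeight μ ν p := by
  unfold couplingWeight commonMass
  have h1 : 0 ≤ dTV μ ν := by unfold dTV; positivity
  have h2 := min_le_left (μ.real {p.1}) (ν.real {p.1})
  have h3 := min_le_right (μ.real {p.2}) (ν.real {p.2})
  have h4 : 0 ≤ min (μ.real {p.1}) (ν.real {p.1}) := by positivity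
  refine add_nonneg (by split_ifs <;> simp [h4]) (div_nonneg (mul_nonneg ?_ ?_) h1) <;> linarith

theorem dTV_comm (μ ν : Measure E) : dTV μ ν = dTV ν μ := by
  simp [dTV, abs_sub_comm]

theorem couplingWeight_swap (μ ν : Measure E) (p : E × E) :
    couplingWeight ν μ p.swap = couplingWeight μ ν p := by
  unfold couplingWeight
  rw [dTV_comm ν μ, commonMass_comm ν μ]
  by_cases h : p.1 = p.2
  · simp [h]; ring
  · simp [h, Ne.symm h]; ring

theorem measurable_couplingWeight {Ω : Type*} [MeasurableSpace Ω] {κ η : Ω → Measure E}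
    (hκ : ∀ e, Measurable fun a => κ a {e}) (hη : ∀ e, Measurable fun a => η a {e}) (p : E × E) :
    Measurable fun a => couplingWeight (κ a) (η a) p := by
  have h1 : ∀ e, Measurable fun a => (κ a).real {e} := fun e => (hκ e).ennreal_toReal
  have h2 : ∀ e, Measurable fun a => (η a).real {e} := fun e => (hη e).ennreal_toReal
  have h3 : ∀ e, Measurable fun a => commonMass (κ a) (η a) e := fun e => (h1 e).min (h2 e)
  have h4 : Measurable fun a => dTV (κ a) (η a) := by
    unfold dTV
    exact (Finset.measurable_sum _ fun e _ => ((h1 e).sub (h2 e)).abs).const_mul _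
  unfold couplingWeight
  refine Measurable.add ?_ ((((h1 _).sub (h3 _)).mul ((h2 _).sub (h3 _))).div h4)
  split_ifs
  · exact h3 _
  · exact measurable_const

variable [DiscreteMeasurableSpace E]

theorem maxCoupling_singleton (μ ν : Measure E) (p : E × E) :
    maxCoupling μ ν {p} = ENNReal.ofReal (couplingWeight μ ν p) := by
  classical
  simp only [maxCoupling, Measure.coe_finsetSum, Finset.sum_apply, Measure.smul_apply,
    smul_eq_mul]
  rw [Finset.sum_eq_single p]
  · simp
  · intro b _ hb
    simp [hb]
  · simp

theorem maxCoupling_apply_finset (μ ν : Measure E) (s : Finset (E × E)) :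
    maxCoupling μ ν s = ENNReal.ofReal (∑ p ∈ s, couplingWeight μ ν p) := by
  rw [← sum_measure_singleton, ENNReal.ofReal_sum_of_nonneg
    (fun p _ => couplingWeight_nonneg μ ν p)]
  simp only [maxCoupling_singleton]

theorem sum_real_singleton_eq_one (μ : Measure E) [IsProbabilityMeasure μ] :
    ∑ e : E, μ.real {e} = 1 := by
  rw [sum_measureReal_singleton]
  simp

/-- Pointwise $|a-b|=2(a-\min(a,b))+(b-a)$, and the last term sums to zero for probability measures.
-/
theorem dTV_eq_sum_sub_left (μ ν : Measure E) [IsProbabilityMeasure μ] [IsProbabilityMeasure ν] :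
    ∑ e : E, (μ.real {e} - commonMass μ ν e) = dTV μ ν := by
  have h : ∀ e, |μ.real {e} - ν.real {e}| =
      2 * (μ.real {e} - commonMass μ ν e) + (ν.real {e} - μ.real {e}) := by
    intro e
    unfold commonMass
    rcases le_total (μ.real {e}) (ν.real {e}) with h | h
    · rw [min_eq_left h, abs_of_nonpos (by linarith)]; ring
    · rw [min_eq_right h, abs_of_nonneg (by linarith)]; ring
  unfold dTV
  simp only [h]
  have h0 : ∑ e : E, (ν.real {e} - μ.real {e}) = 0 := by
    rw [Finset.sum_sub_distrib, sum_real_singleton_eq_one, sum_real_singleton_eq_one, sub_self]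
  rw [Finset.sum_add_distrib, h0, ← Finset.mul_sum]
  ring

variable (μ ν : Measure E) [IsProbabilityMeasure μ] [IsProbabilityMeasure ν]

theorem sum_couplingWeight_snd (e : E) : ∑ e', couplingWeight μ ν (e, e') = μ.real {e} := by
  classical
  simp only [couplingWeight, Finset.sum_add_distrib, Finset.sum_ite_eq, Finset.mem_univ, if_true]
  rw [← Finset.sum_div, ← Finset.mul_sum]
  have h2 := dTV_eq_sum_sub_left ν μ
  rw [dTV_comm, commonMass_comm] at h2
  rw [h2]
  -- At distance zero the quotient in the weight is `0` by convention, which is harmless: the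
  -- residual masses vanish as well.
  by_cases hd : dTV μ ν = 0
  · have h1 := dTV_eq_sum_sub_left μ ν
    rw [hd, Finset.sum_eq_zero_iff_of_nonneg
      (fun e _ => sub_nonneg.2 (min_le_left _ _))] at h1
    have := h1 e (Finset.mem_univ e)
    rw [hd]
    simp
    linarith
  · field_simp
    ring

theorem sum_couplingWeight_fst (e : E) : ∑ e', couplingWeight μ ν (e', e) = ν.real {e} := by
  rw [← sum_couplingWeight_snd ν μ e]
  exact Finset.sum_congr rfl fun e' _ => (couplingWeight_swap μ ν (e', e)).symm

theorem maxCoupling_fst (e : E) : maxCoupling μ ν (Prod.fst ⁻¹' {e}) = μ {e} := by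
  classical
  have h : (Prod.fst ⁻¹' {e} : Set (E × E)) = (({e} ×ˢ Finset.univ : Finset (E × E)) : Set _) := by
    ext p; simp [Prod.ext_iff, eq_comm]
  rw [h, maxCoupling_apply_finset, Finset.sum_product, Finset.sum_singleton,
    sum_couplingWeight_snd, ofReal_measureReal]

theorem maxCoupling_snd (e : E) : maxCoupling μ ν (Prod.snd ⁻¹' {e}) = ν {e} := by
  classical
  have h : (Prod.snd ⁻¹' {e} : Set (E × E)) = ((Finset.univ ×ˢ {e} : Finset (E × E)) : Set _) := by
    ext p; simp [Prod.ext_iff, eq_comm]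
  rw [h, maxCoupling_apply_finset, Finset.sum_product_right, Finset.sum_singleton,
    sum_couplingWeight_fst, ofReal_measureReal]

instance : IsProbabilityMeasure (maxCoupling μ ν) := by
  constructor
  rw [← Finset.coe_univ, maxCoupling_apply_finset, Fintype.sum_prod_type]
  simp only [sum_couplingWeight_snd, sum_real_singleton_eq_one, ENNReal.ofReal_one]

/-- Only the product of the residual masses charges the off-diagonal; each residual has total mass
`dTV μ ν`, so the quotient sums to at most $d\cdot d/d=d$. -/
theorem maxCoupling_ne_le : maxCoupling μ ν {p | p.1 ≠ p.2} ≤ ENNReal.ofReal (dTV μ ν) := by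
  classical
  have h : {p : E × E | p.1 ≠ p.2} = ((Finset.univ.filter fun p : E × E => p.1 ≠ p.2 :
      Finset (E × E)) : Set _) := by
    ext p; simp
  rw [h, maxCoupling_apply_finset]
  apply ENNReal.ofReal_le_ofReal
  have h1 : ∑ p ∈ Finset.univ.filter (fun p : E × E => p.1 ≠ p.2), couplingWeight μ ν p ≤
      ∑ p : E × E, (μ.real {p.1} - commonMass μ ν p.1) * (ν.real {p.2} - commonMass μ ν p.2) /
        dTV μ ν := by
    rw [Finset.sum_filter]
    refine Finset.sum_le_sum fun p _ => ?_
    split_ifs with hp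
    · simp [couplingWeight, hp]
    · exact div_nonneg (mul_nonneg (sub_nonneg.2 (min_le_left _ _))
        (sub_nonneg.2 (min_le_right _ _))) (dTV_mem_Icc μ ν).1
  refine h1.trans ?_
  have h2 := dTV_eq_sum_sub_left ν μ
  rw [dTV_comm, commonMass_comm] at h2
  rw [← Finset.sum_div, Fintype.sum_prod_type]
  simp only [← Finset.mul_sum, h2]
  rw [← Finset.sum_mul, dTV_eq_sum_sub_left]
  exact (mul_self_div_self _).le

end Coupling

/-! ### The coupled transition kernel -/

section CoupledKernel

variable {E : Type*} [Fintype E] [MeasurableSpace E] [DiscreteMeasurableSpace E]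

/-- The kernel that moves a pair of pasts by the maximal coupling of the two transition laws. -/
def coupledKernel (κ η : Kernel (ℕ → E) E) : Kernel (ℕ → E × E) (E × E) where
  toFun v := maxCoupling (κ fun i => (v i).1) (η fun i => (v i).2)
  measurable' := by
    refine Measure.measurable_of_measurable_coe _ fun s _ => ?_
    simp only [maxCoupling, Measure.coe_finsetSum, Finset.sum_apply, Measure.smul_apply,
      smul_eq_mul]
    refine Finset.measurable_sum _ fun p _ => Measurable.mul_const ?_ _
    exact (measurable_couplingWeight
      (fun e => (κ.measurable_coe (measurableSet_singleton e)).comp (by fun_prop))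
      (fun e => (η.measurable_coe (measurableSet_singleton e)).comp (by fun_prop)) p).ennreal_ofReal

theorem coupledKernel_apply (κ η : Kernel (ℕ → E) E) (v : ℕ → E × E) :
    coupledKernel κ η v = maxCoupling (κ fun i => (v i).1) (η fun i => (v i).2) := rfl

instance (κ η : Kernel (ℕ → E) E) [IsMarkovKernel κ] [IsMarkovKernel η] :
    IsMarkovKernel (coupledKernel κ η) :=
  ⟨fun v => by rw [coupledKernel_apply]; infer_instance⟩

end CoupledKernel

/-! ### Return probabilities of the renewal chain -/

section Renewal

/-- `returnProb b m i` is the probability that the chain with kernel `renewalKernel b` started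
from `i` is at `0` after `m` steps. -/
def returnProb (b : ℕ → ℝ) : ℕ → ℕ → ℝ
  | 0, i => if i = 0 then 1 else 0
  | m + 1, i => b i * returnProb b m 0 + (1 - b i) * returnProb b m (i + 1)

variable {b : ℕ → ℝ}

theorem returnProb_nonneg (hb : ∀ i, b i ∈ Set.Icc (0 : ℝ) 1) (m i : ℕ) : 0 ≤ returnProb b m i := by
  induction m generalizing i with
  | zero => unfold returnProb; positivity
  | succ m ih =>
    exact add_nonneg (mul_nonneg (hb i).1 (ih 0)) (mul_nonneg (sub_nonneg.2 (hb i).2) (ih _))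

theorem returnProb_antitone (hb : ∀ i, b i ∈ Set.Icc (0 : ℝ) 1)
    (hanti : Antitone b) (m : ℕ) : Antitone (returnProb b m) := by
  induction m with
  | zero =>
    intro i j hij
    unfold returnProb
    split_ifs <;> first | omega | norm_num
  | succ m ih =>
    refine antitone_nat_of_succ_le fun i => ?_
    simp only [returnProb]
    have h1 := ih (Nat.zero_le (i + 1))
    have h2 := ih (Nat.le_succ (i + 1))
    have h3 := hanti (Nat.le_succ i)
    have h4 := (hb (i + 1)).2
    simp only [Nat.succ_eq_add_one] at h2 h3
    -- The decrement $R_{m+1}(i)-R_{m+1}(i+1)$ equals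
    -- $(b_i-b_{i+1})(R_m(0)-R_m(i+1))+(1-b_{i+1})(R_m(i+1)-R_m(i+2))$.
    nlinarith [mul_nonneg (sub_nonneg.2 h3) (sub_nonneg.2 h1),
      mul_nonneg (sub_nonneg.2 h4) (sub_nonneg.2 h2)]

/-- $R_{m+1}(0)$ is an average of $R_m(0)$ and $R_m(1)\le R_m(0)$. -/
theorem returnProb_succ_zero_le (hb : ∀ i, b i ∈ Set.Icc (0 : ℝ) 1)
    (hanti : Antitone b) (m : ℕ) :
    returnProb b (m + 1) 0 ≤ returnProb b m 0 := by
  have h1 := returnProb_antitone hb hanti m (Nat.zero_le 1)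
  simp only [returnProb]
  nlinarith [mul_nonneg (sub_nonneg.2 (hb 0).2) (sub_nonneg.2 h1)]

theorem lintegral_renewalKernel_returnProb (hb : ∀ i, b i ∈ Set.Icc (0 : ℝ) 1) (m i : ℕ) :
    ∫⁻ j, ENNReal.ofReal (returnProb b m j) ∂renewalKernel b i =
      ENNReal.ofReal (returnProb b (m + 1) i) := by
  have h : renewalKernel b i = ENNReal.ofReal (1 - b i) • Measure.dirac (i + 1) +
    ENNReal.ofReal (b i) • Measure.dirac 0 := rfl
  have h1 := mul_nonneg (hb i).1 (returnProb_nonneg hb m 0)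
  have h2 := mul_nonneg (sub_nonneg.2 (hb i).2) (returnProb_nonneg hb m (i + 1))
  rw [h, lintegral_add_measure, lintegral_smul_measure, lintegral_smul_measure, lintegral_dirac,
    lintegral_dirac, smul_eq_mul, smul_eq_mul, ← ENNReal.ofReal_mul (sub_nonneg.2 (hb i).2),
    ← ENNReal.ofReal_mul (hb i).1, ← ENNReal.ofReal_add h2 h1, add_comm]
  rfl

theorem renewalLaw_zero_eq (hb : ∀ i, b i ∈ Set.Icc (0 : ℝ) 1) (n : ℕ) :
    (renewalLaw b hb).real {S | S n.succPNat = 0} = returnProb b (n + 1) 0 := by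
  have := isMarkovKernel_renewalKernel hb
  set κ : ℤ → Kernel (ℕ → ℕ) ℕ :=
    fun _ => (renewalKernel b).comap (fun y : ℕ → ℕ => y 0) (measurable_pi_apply 0) with hκ
  set z : ℕ → ℕ := fun _ => 0 with hz
  -- Martingale property: the mean of $R_{n+1-k}(S_k)$ does not depend on `k`. At `k = n + 1` it is
  -- the probability of being at `0`.
  have key : ∀ k m, k + m = n + 1 →
      ∫⁻ w, ENNReal.ofReal (returnProb b m (past z k (history k w) 0)) ∂trajLaw κ 0 z =
        ENNReal.ofReal (returnProb b (n + 1) 0) := by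
    intro k
    induction k with
    | zero =>
      intro m hm
      rw [zero_add] at hm
      simp [past, hz, hm]
    | succ k ih =>
      intro m hm
      rw [← ih (m + 1) (by omega)]
      simp only [past_succ_zero]
      rw [lintegral_trajLaw_succ κ 0 z k (F := fun p => ENNReal.ofReal (returnProb b m p.2))
        ((measurable_of_countable fun j : ℕ => ENNReal.ofReal (returnProb b m j)).comp
          measurable_snd)]
      refine lintegral_congr fun w => ?_
      exact lintegral_renewalKernel_returnProb hb m _
  have h := key (n + 1) 0 rfl
  have hA : MeasurableSet {S : ℕ+ → ℕ | S n.succPNat = 0} :=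
    measurable_pi_apply n.succPNat (measurableSet_singleton 0)
  have hA' : MeasurableSet {w : ℕ → ℕ | w (n + 1) = 0} :=
    measurable_pi_apply (n + 1) (measurableSet_singleton 0)
  have hlaw : renewalLaw b hb {S | S n.succPNat = 0} = ENNReal.ofReal (returnProb b (n + 1) 0) := by
    rw [← h]
    refine (pathLaw_apply κ 0 z hA).trans ?_
    change trajLaw κ 0 z {w : ℕ → ℕ | w (n + 1) = 0} = _
    rw [← lintegral_indicator_one hA']
    refine lintegral_congr fun w => ?_
    rw [past_succ_zero]
    by_cases hw : w (n + 1) = 0 <;> simp [hw, returnProb]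
  rw [measureReal_def, hlaw, ENNReal.toReal_ofReal (returnProb_nonneg hb _ _)]

theorem starCoeff_zero (hb : ∀ i, b i ∈ Set.Icc (0 : ℝ) 1) :
    starCoeff b hb 0 = returnProb b 1 0 := by
  simp [starCoeff, returnProb]

theorem starCoeff_succ (hb : ∀ i, b i ∈ Set.Icc (0 : ℝ) 1) (n : ℕ) : starCoeff b hb (n + 1) = returnProb b (n + 1) 0 :=
  renewalLaw_zero_eq hb n

/-- The index shift absorbs the convention $b^*_0=b_0$, which is $R_1(0)$ and not $R_0(0)=1$; for
positive indices one step of monotonicity in time is given up. -/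
theorem returnProb_le_starCoeff (hb : ∀ i, b i ∈ Set.Icc (0 : ℝ) 1)
    (hanti : Antitone b) (n : ℕ) :
    returnProb b (n + 1) 0 ≤ starCoeff b hb n := by
  cases n with
  | zero => exact (starCoeff_zero hb).ge
  | succ n =>
    rw [starCoeff_succ]
    exact returnProb_succ_zero_le hb hanti _

end Renewal

/-! ### Length of the current run of agreements -/

section RunLength

variable {E : Type*}

open Classical in
/-- The number of consecutive agreements of the two components of a history, counted backwards
from time `n` and down to time `1`. -/
def runLength : (n : ℕ) → (Finset.Iic n → E × E) → ℕ
  | 0, _ => 0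
  | n + 1, h =>
    if (h ⟨n + 1, Finset.mem_Iic.2 le_rfl⟩).1 = (h ⟨n + 1, Finset.mem_Iic.2 le_rfl⟩).2 then
      runLength n (Preorder.frestrictLe₂ (π := fun _ => E × E) (Nat.le_succ n) h) + 1
    else 0

open Classical in
theorem runLength_succ (n : ℕ) (w : ℕ → E × E) :
    runLength (n + 1) (history (n + 1) w) =
      if (w (n + 1)).1 = (w (n + 1)).2 then runLength n (history n w) + 1 else 0 := rfl

/-- This turns the run length into the agreement hypothesis in the definition of $b_m$. The count
stops at time `1`, so nothing is required of the initial pasts `v`. -/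
theorem past_agree_of_lt_runLength (v : ℕ → E × E) (n : ℕ) (w : ℕ → E × E) (i : ℕ)
    (hi : i < runLength n (history n w)) :
    (past v n (history n w) i).1 = (past v n (history n w) i).2 := by
  induction n generalizing i with
  | zero => simp [runLength] at hi
  | succ n ih =>
    rw [runLength_succ] at hi
    split_ifs at hi with hw
    · cases i with
      | zero => rwa [past_succ_zero]
      | succ i =>
        rw [past_succ_succ]
        exact ih i (by omega)
    · omega

end RunLength

/-! ### Comparison of the run length with the renewal chain -/

section Estimate

variable {E 𝒳 : Type*} [Fintype E] [MeasurableSpace E] [DiscreteMeasurableSpace E]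
  (q : ℤ → 𝒳 → Kernel (ℕ → E) E) [∀ t x, IsMarkovKernel (q t x)]

theorem dTV_le_contCoeff (t : ℤ) (x : 𝒳) {m : ℕ} {y y' : ℕ → E} (h : ∀ i < m, y i = y' i) :
    dTV (q t x y) (q t x y') ≤ contCoeff q m := by
  refine le_csSup ⟨1, ?_⟩ ⟨t, x, y, y', h, rfl⟩
  rintro r ⟨t, x, y, y', -, rfl⟩
  exact (dTV_mem_Icc _ _).2

theorem contCoeff_antitone : Antitone (contCoeff q) := by
  intro m n hmn
  refine Real.sSup_le ?_ (contCoeff_mem_Icc q m).1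
  rintro r ⟨t, x, y, y', h, rfl⟩
  exact dTV_le_contCoeff q t x fun i hi => h i (hi.trans_le hmn)

theorem dTV_le_iSup (κ η : Kernel (ℕ → E) E) [IsMarkovKernel κ] [IsMarkovKernel η] (s : ℕ → E) :
    dTV (κ s) (η s) ≤ ⨆ s, dTV (κ s) (η s) := by
  refine le_ciSup (f := fun s => dTV (κ s) (η s)) ⟨1, ?_⟩ s
  rintro _ ⟨s, rfl⟩
  exact (dTV_mem_Icc _ _).2

theorem iSup_dTV_nonneg (κ η : Kernel (ℕ → E) E) [IsMarkovKernel κ] [IsMarkovKernel η] :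
    0 ≤ ⨆ s, dTV (κ s) (η s) :=
  Real.iSup_nonneg fun _ => (dTV_mem_Icc _ _).1

/-- Averaging, over a step of a coupling that fails with probability at most `b i + δ`, of the
return probability from the updated run length. -/
theorem lintegral_returnProb_le {b : ℕ → ℝ} (hb : ∀ i, b i ∈ Set.Icc (0 : ℝ) 1)
    (hanti : Antitone b) (ρ : Measure (E × E)) [IsProbabilityMeasure ρ] (i : ℕ) {δ : ℝ}
    (hδ : 0 ≤ δ) (hρ : ρ {p | p.1 ≠ p.2} ≤ ENNReal.ofReal (b i + δ)) (m : ℕ)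
    [DecidablePred fun p : E × E => p.1 = p.2] :
    ∫⁻ p, ENNReal.ofReal (returnProb b m (if p.1 = p.2 then i + 1 else 0)) ∂ρ ≤
      ENNReal.ofReal (returnProb b (m + 1) i + δ * returnProb b m 0) := by
  set D : Set (E × E) := {p | p.1 ≠ p.2}
  have hD : MeasurableSet D := MeasurableSet.of_discrete
  have h0 := returnProb_nonneg hb m 0
  have h1 := returnProb_nonneg hb m (i + 1)
  have hint : ∫⁻ p, ENNReal.ofReal (returnProb b m (if p.1 = p.2 then i + 1 else 0)) ∂ρ =
      ENNReal.ofReal (ρ.real D * returnProb b m 0 + (1 - ρ.real D) * returnProb b m (i + 1)) := by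
    rw [← lintegral_add_compl _ hD,
      setLIntegral_congr_fun (g := fun _ => ENNReal.ofReal (returnProb b m 0)) hD,
      setLIntegral_congr_fun (g := fun _ => ENNReal.ofReal (returnProb b m (i + 1))) hD.compl,
      setLIntegral_const, setLIntegral_const, ← ofReal_measureReal (μ := ρ) (s := D),
      ← ofReal_measureReal (μ := ρ) (s := Dᶜ), ← ENNReal.ofReal_mul h0, ← ENNReal.ofReal_mul h1,
      ← ENNReal.ofReal_add (by positivity) (by positivity), probReal_compl_eq_one_sub hD]
    · congr 1; ring
    · intro p hp
      have : p.1 = p.2 := not_not.1 hp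
      simp [this]
    · intro p hp
      have : ¬ p.1 = p.2 := hp
      simp [this]
  rw [hint]
  apply ENNReal.ofReal_le_ofReal
  have hp : ρ.real D ≤ b i + δ := ENNReal.toReal_le_of_le_ofReal (add_nonneg (hb i).1 hδ) hρ
  have h2 := returnProb_antitone hb hanti m (Nat.zero_le (i + 1))
  simp only [returnProb]
  -- With failure probability $p$, the average $pR_m(0)+(1-p)R_m(i+1)$ is nondecreasing in $p$. Its
  -- value at $p=b_i+\delta$ is $R_{m+1}(i)+\delta(R_m(0)-R_m(i+1))$, and the negative term is
  -- dropped.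
  nlinarith [mul_nonneg (sub_nonneg.2 hp) (sub_nonneg.2 h2), mul_nonneg hδ h1]

variable (qbar : ℤ → 𝒳 → Kernel (ℕ → E) E) [∀ t x, IsMarkovKernel (qbar t x)]

/-- The intermediate law is `q` at the second past: changing the past costs $b_m$, changing the
kernel costs the supremum. -/
theorem coupledKernel_ne_le (t : ℤ) (x : 𝒳) (v : ℕ → E × E) (m : ℕ)
    (hv : ∀ i < m, (v i).1 = (v i).2) :
    coupledKernel (q t x) (qbar t x) v {p | p.1 ≠ p.2} ≤
      ENNReal.ofReal (contCoeff q m + ⨆ s, dTV (q t x s) (qbar t x s)) := by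
  rw [coupledKernel_apply]
  refine (maxCoupling_ne_le _ _).trans (ENNReal.ofReal_le_ofReal ?_)
  exact (dTV_triangle _ (q t x fun i => (v i).2) _).trans
    (add_le_add (dTV_le_contCoeff q t x hv) (dTV_le_iSup _ _ _))

theorem trajLaw_coupled_ne_le (x : 𝒳) (t₀ : ℤ) (v : ℕ → E × E) (n : ℕ) :
    trajLaw (fun t => coupledKernel (q t x) (qbar t x)) t₀ v {w | (w (n + 1)).1 ≠ (w (n + 1)).2} ≤
      ENNReal.ofReal (returnProb (contCoeff q) (n + 1) 0 + ∑ j ∈ Finset.range (n + 1),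
        (⨆ s, dTV (q (t₀ + j + 1) x s) (qbar (t₀ + j + 1) x s)) *
          returnProb (contCoeff q) (n - j) 0) := by
  classical
  set b := contCoeff q
  have hb : ∀ i, b i ∈ Set.Icc (0 : ℝ) 1 := contCoeff_mem_Icc q
  have hanti : Antitone b := contCoeff_antitone q
  set κ : ℤ → Kernel (ℕ → E × E) (E × E) := fun t => coupledKernel (q t x) (qbar t x)
  set δ : ℕ → ℝ := fun j => ⨆ s, dTV (q (t₀ + j + 1) x s) (qbar (t₀ + j + 1) x s)
  have hδ : ∀ j, 0 ≤ δ j := fun j => iSup_dTV_nonneg _ _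
  -- Almost a supermartingale: the mean of $R_{n+1-k}(L_k)$ grows by at most $\delta_kR_{n-k}(0)$
  -- from time `k` to `k + 1`. At `k = n + 1`, $R_0(L_{n+1})$ is the indicator of a disagreement.
  have key : ∀ k m, k + m = n + 1 →
      ∫⁻ w, ENNReal.ofReal (returnProb b m (runLength k (history k w))) ∂trajLaw κ t₀ v ≤
        ENNReal.ofReal (returnProb b (n + 1) 0 +
          ∑ j ∈ Finset.range k, δ j * returnProb b (n - j) 0) := by
    intro k
    induction k with
    | zero =>
      intro m hm
      rw [zero_add] at hm
      simp [runLength, hm]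
    | succ k ih =>
      intro m hm
      have hnk : n - k = m := by omega
      simp only [runLength_succ]
      rw [lintegral_trajLaw_succ κ t₀ v k (F := fun p => ENNReal.ofReal
        (returnProb b m (if p.2.1 = p.2.2 then runLength k p.1 + 1 else 0))) Measurable.of_discrete]
      have hstep : ∀ w : ℕ → E × E, ∫⁻ p, ENNReal.ofReal
          (returnProb b m (if p.1 = p.2 then runLength k (history k w) + 1 else 0))
            ∂κ (t₀ + k + 1) (past v k (history k w)) ≤
          ENNReal.ofReal (returnProb b (m + 1) (runLength k (history k w))) +
            ENNReal.ofReal (δ k * returnProb b m 0) := by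
        intro w
        rw [← ENNReal.ofReal_add (returnProb_nonneg hb _ _)
          (mul_nonneg (hδ k) (returnProb_nonneg hb _ _))]
        exact lintegral_returnProb_le hb hanti _ _ (hδ k)
          (coupledKernel_ne_le q qbar _ x _ _ (past_agree_of_lt_runLength v k w)) m
      refine (lintegral_mono hstep).trans ?_
      rw [lintegral_add_right _ measurable_const, lintegral_const, measure_univ, mul_one,
        Finset.sum_range_succ, ← add_assoc, hnk, ENNReal.ofReal_add (p := _ + _)
          (add_nonneg (returnProb_nonneg hb _ _) (Finset.sum_nonneg fun j _ =>
            mul_nonneg (hδ j) (returnProb_nonneg hb _ _)))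
          (mul_nonneg (hδ k) (returnProb_nonneg hb _ _))]
      gcongr
      exact ih (m + 1) (by omega)
  refine le_trans (le_of_eq ?_) (key (n + 1) 0 rfl)
  have hA : MeasurableSet {w : ℕ → E × E | (w (n + 1)).1 ≠ (w (n + 1)).2} :=
    (measurable_pi_apply (n + 1) : Measurable fun w : ℕ → E × E => w (n + 1))
      (MeasurableSet.of_discrete (s := {p : E × E | p.1 ≠ p.2}))
  rw [← lintegral_indicator_one hA]
  refine lintegral_congr fun w => ?_
  rw [runLength_succ]
  by_cases hw : (w (n + 1)).1 = (w (n + 1)).2 <;> simp [hw, returnProb]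

end Estimate

/-! ### Measurability in the parameters and the conclusion -/

section Main

variable {E 𝒳 : Type*} [Fintype E] [MeasurableSpace E] [DiscreteMeasurableSpace E]

/-- It is enough to check cylinders, whose probabilities are finite products of coupling weights;
with the path values fixed, the past is a measurable function of the initial past. -/
theorem measurable_pathLaw_coupled [MeasurableSpace 𝒳]
    (q qbar : ℤ → 𝒳 → Kernel (ℕ → E) E)
    [∀ t x, IsMarkovKernel (q t x)] [∀ t x, IsMarkovKernel (qbar t x)]
    (hq : ∀ t : ℤ, Measurable fun p : E × (ℕ → E) × 𝒳 => q t p.2.2 p.2.1 {p.1})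
    (hqbar : ∀ t : ℤ, Measurable fun p : E × (ℕ → E) × 𝒳 => qbar t p.2.2 p.2.1 {p.1}) (t₀ : ℤ) :
    Measurable fun p : 𝒳 × (ℕ → E) × (ℕ → E) =>
      pathLaw (fun t => coupledKernel (q t p.1) (qbar t p.1)) t₀
        (fun j => (p.2.1 j, p.2.2 j)) := by
  refine Measurable.measure_of_isPiSystem_of_isProbabilityMeasure
    (generateFrom_pathCylinders (E × E)) (isPiSystem_pathCylinders (E × E)) ?_
  rintro _ ⟨n, y, rfl⟩
  simp only [pathLaw_cylinder]
  refine Finset.measurable_prod _ fun i _ => ?_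
  simp only [coupledKernel_apply, maxCoupling_singleton]
  refine (measurable_couplingWeight (fun e => ?_) (fun e => ?_) _).ennreal_ofReal
  · simp only [map_past Prod.fst]
    exact (hq (t₀ + i + 1)).comp (measurable_const (a := e) |>.prodMk
      (((measurable_past_left i fun k => (y k).1).comp (measurable_fst.comp measurable_snd)).prodMk
        measurable_fst))
  · simp only [map_past Prod.snd]
    exact (hqbar (t₀ + i + 1)).comp (measurable_const (a := e) |>.prodMk
      (((measurable_past_left i fun k => (y k).2).comp (measurable_snd.comp measurable_snd)).prodMk
        measurable_fst))

end Main

end CompleteConnections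

end

open CompleteConnections in
theorem lemma1 {E 𝒳 : Type*}
    [Fintype E] [MeasurableSpace E] [DiscreteMeasurableSpace E]
    [TopologicalSpace 𝒳] [PolishSpace 𝒳] [MeasurableSpace 𝒳] [BorelSpace 𝒳]
    (q qbar : ℤ → 𝒳 → Kernel (ℕ → E) E)
    [∀ t x, IsMarkovKernel (q t x)] [∀ t x, IsMarkovKernel (qbar t x)]
    (hq_meas : ∀ t : ℤ, Measurable fun p : E × (ℕ → E) × 𝒳 => q t p.2.2 p.2.1 {p.1})
    (hqbar_meas : ∀ t : ℤ, Measurable fun p : E × (ℕ → E) × 𝒳 => qbar t p.2.2 p.2.1 {p.1})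
    (hq_pos : ∀ (t : ℤ) (x : 𝒳) (z : ℕ → E) (y : E), 0 < q t x z {y})
    (hqbar_pos : ∀ (t : ℤ) (x : 𝒳) (z : ℕ → E) (y : E), 0 < qbar t x z {y})
    (hb_zero : contCoeff q 0 < 1)
    (hb_lim : Tendsto (contCoeff q) atTop (𝓝 0))
    (t₀ : ℤ) :
    ∃ Q : 𝒳 → (ℕ → E) → (ℕ → E) → Measure ((ℕ+ → E) × (ℕ+ → E)),
      (∀ x z zbar, IsProbabilityMeasure (Q x z zbar)) ∧
      (∀ x z zbar,
        (∀ A : Set (ℕ+ → E), MeasurableSet A →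
          Q x z zbar (A ×ˢ Set.univ) = pathLaw (fun t => q t x) t₀ z A) ∧
        (∀ B : Set (ℕ+ → E), MeasurableSet B →
          Q x z zbar (Set.univ ×ˢ B) = pathLaw (fun t => qbar t x) t₀ zbar B)) ∧
      (∀ x z zbar, ∀ t : ℕ, ∀ ht : 1 ≤ t,
        (Q x z zbar).real {p | p.1 ⟨t, ht⟩ ≠ p.2 ⟨t, ht⟩} ≤
          bStar q (t - 1)
          + (⨆ s : ℕ → E, dTV (q (t + t₀) x s) (qbar (t + t₀) x s))
          + ∑ ℓ ∈ Finset.range (t - 1), bStar q ℓ *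
              ⨆ s : ℕ → E, dTV (q (t + t₀ - ℓ - 1) x s) (qbar (t + t₀ - ℓ - 1) x s)) ∧
      (∀ C : Set ((ℕ+ → E) × (ℕ+ → E)), MeasurableSet C →
        Measurable fun p : 𝒳 × (ℕ → E) × (ℕ → E) => Q p.1 p.2.1 p.2.2 C) := by
  set unzip : (ℕ+ → E × E) → (ℕ+ → E) × (ℕ+ → E) :=
    fun w => (fun i => (w i).1, fun i => (w i).2) with hunzip_def
  have hunzip : Measurable unzip := by fun_prop
  refine ⟨fun x z zbar => (pathLaw (fun t => coupledKernel (q t x) (qbar t x)) t₀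
    (fun j => (z j, zbar j))).map unzip, ?_, ?_, ?_, ?_⟩
  · intro x z zbar
    exact Measure.isProbabilityMeasure_map hunzip.aemeasurable
  · intro x z zbar
    constructor
    · intro A hA
      rw [Measure.map_apply hunzip (hA.prod MeasurableSet.univ),
        ← map_pathLaw (z := fun j => (z j, zbar j)) measurable_fst
          (fun t => coupledKernel (q t x) (qbar t x)) (fun t => q t x)
          (fun t v e => maxCoupling_fst _ _ e), Measure.map_apply (by fun_prop) hA]
      congr 1
      ext w
      simp [hunzip_def]
    · intro B hB
      rw [Measure.map_apply hunzip (MeasurableSet.univ.prod hB),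
        ← map_pathLaw (z := fun j => (z j, zbar j)) measurable_snd
          (fun t => coupledKernel (q t x) (qbar t x)) (fun t => qbar t x)
          (fun t v e => maxCoupling_snd _ _ e), Measure.map_apply (by fun_prop) hB]
      congr 1
      ext w
      simp [hunzip_def]
  · intro x z zbar t ht
    obtain ⟨n, rfl⟩ : ∃ n, t = n + 1 := ⟨t - 1, by omega⟩
    have hC : MeasurableSet {p : (ℕ+ → E) × (ℕ+ → E) | p.1 ⟨n + 1, ht⟩ ≠ p.2 ⟨n + 1, ht⟩} :=
      (show Measurable fun p : (ℕ+ → E) × (ℕ+ → E) => (p.1 ⟨n + 1, ht⟩, p.2 ⟨n + 1, ht⟩) by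
        fun_prop) (MeasurableSet.of_discrete (s := {p : E × E | p.1 ≠ p.2}))
    set b := contCoeff q
    have hb : ∀ i, b i ∈ Set.Icc (0 : ℝ) 1 := contCoeff_mem_Icc q
    have hanti : Antitone b := contCoeff_antitone q
    have hle := trajLaw_coupled_ne_le q qbar x t₀ (fun j => (z j, zbar j)) n
    have hδ : ∀ t : ℤ, 0 ≤ ⨆ s, dTV (q t x s) (qbar t x s) := fun t => iSup_dTV_nonneg _ _
    rw [measureReal_def, Measure.map_apply hunzip hC, pathLaw_apply _ _ _ (hunzip hC)]
    refine (ENNReal.toReal_le_of_le_ofReal (add_nonneg (returnProb_nonneg hb _ _)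
      (Finset.sum_nonneg fun j _ => mul_nonneg (hδ _) (returnProb_nonneg hb _ _))) hle).trans ?_
    rw [add_tsub_cancel_right, add_assoc]
    refine add_le_add (returnProb_le_starCoeff hb hanti n) ?_
    -- The last summand, `j = n`, carries $R_0(0)=1$ and gives the term without a $b^*$ factor; the
    -- others are reindexed by `j = n - 1 - ℓ`, where $R_{\ell+1}(0)\le b^*_\ell$ applies.
    rw [Finset.sum_range_succ, add_comm, Nat.sub_self, ← Finset.sum_range_reflect]
    refine add_le_add (le_of_eq ?_) (Finset.sum_le_sum fun ℓ hℓ => ?_)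
    · have : (t₀ + n + 1 : ℤ) = ((n + 1 : ℕ) : ℤ) + t₀ := by push_cast; ring
      simp [returnProb, this]
    · have hℓ := Finset.mem_range.1 hℓ
      have h1 : n - (n - 1 - ℓ) = ℓ + 1 := by omega
      have h2 : (t₀ + (n - 1 - ℓ : ℕ) + 1 : ℤ) = ((n + 1 : ℕ) : ℤ) + t₀ - ℓ - 1 := by omega
      rw [h1, h2, mul_comm]
      exact mul_le_mul_of_nonneg_right (returnProb_le_starCoeff hb hanti ℓ) (hδ _)
  · intro C hC
    simp only [Measure.map_apply hunzip hC]
    exact (Measure.measurable_coe (hunzip hC)).comp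
      (measurable_pathLaw_coupled q qbar hq_meas hqbar_meas t₀)
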